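/- A convex body in $\mathbb{R}^d$ is a compact convex set with non-empty interior. For $\theta\in S^{d-1}$ and $t\in\mathbb{R}$ write $\mathfrak{H}_{\theta,t}=\{x\in\mathbb{R}^d:\langle x,\theta\rangle\ge t\}$. For a convex body $K\subset\mathbb{R}^d$ and $\delta>0$, the (convex) floating body of $K$ is $$K_\delta=\bigcap\{\mathfrak{H}_{\theta,t}:\ \theta\in S^{d-1},\ t\in\mathbb{R},\ \mathrm{vol}_d(\mathfrak{H}_{\theta,t}\cap K)\ge(1-\delta)\,\mathrm{vol}_d(K)\}.$$ The body $K$ is called isotropic if a random vector uniformly distributed in $K$ has mean $0$ and covariance matrix $L_K^2 I_d$ for some $L_K>0$. Let $B(0,r)=\{x\in\mathbb{R}^d:\|x\|_2\le r\}$. Consider the following three statements. - Hyperplane conjecture (slicing problem): there exists $c>0$ such that for every integer $d\ge1$ and every convex body $K\subset\mathbb{R}^d$ of unit volume, there is an affine hyperplane $\mathcal{H}\subset\mathbb{R}^d$ with $\mathrm{vol}_{d-1}(\mathcal{H}\cap K)\ge c$. - $\Lambda_1$: there exist $\delta\in(0,e^{-1})$ and $r>0$ such that for every integer $d\ge1$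 and every isotropic convex body $K\subset\mathbb{R}^d$ of unit volume, $K_\delta\subset B(0,r)$. - $\Lambda_2$: for every $\delta\in(0,e^{-1})$ there exists $r>0$ such that for every integer $d\ge1$ and every isotropic convex body $K\subset\mathbb{R}^d$ of unit volume, $K_\delta\subset B(0,r)$. **Theorem 1.** The hyperplane conjecture is equivalent to $\Lambda_1$, and it is equivalent to $\Lambda_2$. -/

import Mathlib

open MeasureTheory ProbabilityTheory

/-- The half-space `{x : ⟨x, θ⟩ ≥ t}` of `ℝᵈ`. -/
def halfSpace {d : ℕ} (θ : EuclideanSpace ℝ (Fin d)) (t : ℝ) : Set (EuclideanSpace ℝ (Fin d)) :=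
  {x | t ≤ inner ℝ x θ}

/-- The hyperplane `{x : ⟨x, θ⟩ = t}` of `ℝᵈ`. -/
def hyperplane {d : ℕ} (θ : EuclideanSpace ℝ (Fin d)) (t : ℝ) : Set (EuclideanSpace ℝ (Fin d)) :=
  {x | inner ℝ x θ = t}

/-- A convex body of `ℝᵈ` in the sense of convex geometry: a compact convex set with non-empty
interior. (Mathlib's `ConvexBody` does not ask for non-empty interior.) -/
def IsFullConvexBody {d : ℕ} (K : Set (EuclideanSpace ℝ (Fin d))) : Prop :=
  Convex ℝ K ∧ IsCompact K ∧ (interior K).Nonempty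

/-- The convex floating body `K_δ`: the intersection of all half-spaces that contain at least the
proportion `1 - δ` of the volume of `K`. -/
def floatingBody {d : ℕ} (K : Set (EuclideanSpace ℝ (Fin d))) (δ : ℝ) :
    Set (EuclideanSpace ℝ (Fin d)) :=
  ⋂₀ {H | ∃ θ : EuclideanSpace ℝ (Fin d), ∃ t : ℝ, ‖θ‖ = 1 ∧ H = halfSpace θ t ∧
    (1 - δ) * volume.real K ≤ volume.real (H ∩ K)}

/-- `K` is isotropic: the uniform probability measure on `K` has its centroid at the origin, and its
covariance matrix is `L ^ 2` times the identity matrix, for some `L > 0`. -/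
def IsIsotropic {d : ℕ} (K : Set (EuclideanSpace ℝ (Fin d))) : Prop :=
  ∫ x, x ∂(cond volume K) = 0 ∧
  ∃ L : ℝ, 0 < L ∧ ∀ i j : Fin d,
    covariance (fun x : EuclideanSpace ℝ (Fin d) => x i) (fun x => x j) (cond volume K) =
      if i = j then L ^ 2 else 0

/-- The hyperplane conjecture (slicing problem): there is a universal constant `c > 0` such that in
every dimension `d ≥ 1`, every convex body of unit volume has a hyperplane section of
`(d - 1)`-dimensional volume at least `c`. Here `μHE[d - 1]` is the Hausdorff measure normalised so
that it is Lebesgue measure on `(d - 1)`-dimensional Euclidean spaces. -/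
def HyperplaneConjecture : Prop :=
  ∃ c : ℝ, 0 < c ∧ ∀ d : ℕ, 1 ≤ d → ∀ K : Set (EuclideanSpace ℝ (Fin d)),
    IsFullConvexBody K → volume K = 1 →
      ∃ θ : EuclideanSpace ℝ (Fin d), ∃ t : ℝ, ‖θ‖ = 1 ∧
        ENNReal.ofReal c ≤ μHE[d - 1] (hyperplane θ t ∩ K)

/-- In every dimension `d ≥ 1`, the floating body `K_δ` of every isotropic convex body `K` of unit
volume is contained in the closed Euclidean ball `B(0, r)`. -/
def FloatingBodiesInBall (δ r : ℝ) : Prop :=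
  ∀ d : ℕ, 1 ≤ d → ∀ K : Set (EuclideanSpace ℝ (Fin d)),
    IsFullConvexBody K → volume K = 1 → IsIsotropic K →
      floatingBody K δ ⊆ Metric.closedBall 0 r

/-- The statement `Λ₁`. -/
def LambdaOne : Prop :=
  ∃ δ ∈ Set.Ioo (0 : ℝ) (Real.exp (-1)), ∃ r : ℝ, 0 < r ∧ FloatingBodiesInBall δ r

/-- The statement `Λ₂`. -/
def LambdaTwo : Prop :=
  ∀ δ ∈ Set.Ioo (0 : ℝ) (Real.exp (-1)), ∃ r : ℝ, 0 < r ∧ FloatingBodiesInBall δ r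

/-! All three statements are equivalent to `IsotropicVarianceLE C` for some C > 0, a dimension-free
bound on the isotropic constant L.

Two facts about a marginal X with log-concave tails and standard deviation σ drive the argument. Its
density is at most √8/σ (`variance_mul_sq_le_of_isLogConcave`, stated for masses of intervals), and
if X is bounded and centred, then X ≥ 0 has probability at least 1/e
(`exp_neg_one_le_measureReal_of_isLogConcave`). Convex bodies have such marginals by
Brunn–Minkowski, derived here from Prékopa–Leindler.

A large section in one direction forces a small variance there, hence, by isotropy, in every
direction. Chebyshev's inequality then confines the floating body to radius √(C/δ). Conversely, for
δ < 1/e the floating body contains a ball of radius proportional to L: a half-space not containing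
this ball leaves out more than δ of the mass, by Grünbaum and the density bound. So Λ₁ bounds L.
Finally, if L is bounded, the volume-preserving map to isotropic position shows that an arbitrary
body has a principal axis of variance at most L², and Chebyshev gives a large section orthogonal to
it. -/

/-! ### Brunn–Minkowski and Prékopa–Leindler inequalities -/

open Set Pointwise in
/-- One-dimensional Brunn–Minkowski inequality. -/
theorem volume_add_volume_le_of_add_subset {A B C : Set ℝ} (hA : MeasurableSet A)
    (hB : MeasurableSet B) (hA0 : A.Nonempty) (hB0 : B.Nonempty) (h : A + B ⊆ C) :
    volume A + volume B ≤ volume C := by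
  have hcomp : ∀ K ⊆ A, ∀ L ⊆ B, IsCompact K → IsCompact L → K.Nonempty → L.Nonempty →
      volume K + volume L ≤ volume C := by
    intro K hK L hL hKc hLc hK0 hL0
    obtain ⟨M, hM, hMub⟩ := hKc.exists_isGreatest hK0
    obtain ⟨m, hm, hmlb⟩ := hLc.exists_isLeast hL0
    -- The translates `K + m` and `M + L` both lie in `C`, and they meet at most in `M + m`, the top
    -- of one and the bottom of the other.
    have hdisj : AEDisjoint volume ((fun x => x + m) '' K) ((fun y => M + y) '' L) := by
      refine measure_mono_null ?_ (Real.volume_singleton (a := M + m))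
      rintro z ⟨⟨x, hx, rfl⟩, ⟨y, hy, hyx⟩⟩
      have h1 := hMub hx
      have h2 := hmlb hy
      simp only at hyx
      simp only [mem_singleton_iff]
      linarith
    have hLm : MeasurableSet ((fun y => M + y) '' L) :=
      (hLc.image (by fun_prop)).isClosed.measurableSet
    calc volume K + volume L
        = volume ((fun x => x + m) '' K) + volume ((fun y => M + y) '' L) := by
          rw [image_add_right, measure_preimage_add_right, image_add_left, measure_preimage_add]
      _ = volume ((fun x => x + m) '' K ∪ (fun y => M + y) '' L) :=
          (measure_union₀ hLm.nullMeasurableSet hdisj).symm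
      _ ≤ volume C := by
          refine measure_mono (union_subset ?_ ?_)
          · rintro _ ⟨x, hx, rfl⟩
            exact h (add_mem_add (hK hx) (hL hm))
          · rintro _ ⟨y, hy, rfl⟩
            exact h (add_mem_add (hK hM) (hL hy))
  obtain ⟨a, ha⟩ := hA0
  obtain ⟨b, hb⟩ := hB0
  rw [hA.measure_eq_iSup_isCompact, hB.measure_eq_iSup_isCompact]
  simp only [iSup_and']
  refine ENNReal.biSup_add_biSup_le' (p := fun K => K ⊆ A ∧ IsCompact K)
    (q := fun K => K ⊆ B ∧ IsCompact K) ⟨∅, by simp⟩ ⟨∅, by simp⟩ ?_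
  rintro K ⟨hKA, hK⟩ L ⟨hLB, hL⟩
  -- The approximating compact sets may be empty; inserting `a` and `b` makes `hcomp` applicable.
  calc volume K + volume L ≤ volume (insert a K) + volume (insert b L) := by
        gcongr <;> exact subset_insert _ _
    _ ≤ volume C := hcomp _ (insert_subset ha hKA) _ (insert_subset hb hLB) (hK.insert a)
        (hL.insert b) (insert_nonempty _ _) (insert_nonempty _ _)

open Set in
theorem lintegral_eq_lintegral_Ioo_meas_lt {f : ℝ → ENNReal} (hf : Measurable f)
    (hf1 : ∀ x, f x ≤ 1) :
    ∫⁻ x, f x = ∫⁻ t in Ioo (0 : ℝ) 1, volume {x | ENNReal.ofReal t < f x} := by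
  have hfin : ∀ x, f x ≠ ⊤ := fun x => ((hf1 x).trans_lt ENNReal.one_lt_top).ne
  have h := lintegral_eq_lintegral_meas_lt (volume : Measure ℝ) (f := fun x => (f x).toReal)
    (Filter.Eventually.of_forall fun x => ENNReal.toReal_nonneg) hf.ennreal_toReal.aemeasurable
  simp only [ENNReal.ofReal_toReal (hfin _)] at h
  have hset : ∀ t : ℝ, 0 < t → {x | t < (f x).toReal} = {x | ENNReal.ofReal t < f x} := by
    intro t ht
    ext x
    simp only [mem_ofPred_eq]
    rw [ENNReal.ofReal_lt_iff_lt_toReal ht.le (hfin x)]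
  rw [h, ← Ioo_union_Ici_eq_Ioi (zero_lt_one (α := ℝ)), lintegral_union measurableSet_Ici
    (by rw [Set.disjoint_left]; intro x hx hx'; exact absurd hx.2 (not_lt.2 hx'))]
  have h0 : ∫⁻ t in Ici (1 : ℝ), volume {x | t < (f x).toReal} = 0 := by
    rw [← lintegral_zero]
    refine setLIntegral_congr_fun measurableSet_Ici fun t ht => ?_
    have : {x | t < (f x).toReal} = ∅ := by
      ext x
      simp only [mem_ofPred_eq, mem_empty_iff_false, iff_false, not_lt]
      exact (ENNReal.toReal_mono ENNReal.one_ne_top (hf1 x)).trans (by simpa using ht)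
    simp [this]
  rw [h0, add_zero]
  exact setLIntegral_congr_fun measurableSet_Ioo fun t ht => by simp only [hset t ht.1]

theorem ENNReal.rpow_mul_rpow_le_add {a b : ℝ} (ha : 0 < a) (hb : 0 < b) (hab : a + b = 1)
    (x y : ENNReal) : x ^ a * y ^ b ≤ ENNReal.ofReal a * x + ENNReal.ofReal b * y := by
  rcases eq_or_ne x ⊤ with rfl | hx
  · simp [ENNReal.mul_top, ha]
  rcases eq_or_ne y ⊤ with rfl | hy
  · simp [ENNReal.mul_top, hb]
  lift x to NNReal using hx
  lift y to NNReal using hy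
  have h := NNReal.geom_mean_le_arith_mean2_weighted ⟨a, ha.le⟩ ⟨b, hb.le⟩ x y (by ext; exact hab)
  rw [← ENNReal.coe_rpow_of_nonneg _ ha.le, ← ENNReal.coe_rpow_of_nonneg _ hb.le,
    ENNReal.ofReal_eq_coe_nnreal ha.le, ENNReal.ofReal_eq_coe_nnreal hb.le]
  exact_mod_cast h

-- Equal suprema make the superlevel sets of `f` and `g` nonempty at exactly the same levels t < 1.
-- There `a • {f > t} + b • {g > t}` lies in `{h > t}`, so one-dimensional Brunn–Minkowski can be
-- integrated over t. The additive form depends on this normalisation.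
open Set Pointwise in
theorem prekopaLeindler_real_of_iSup_eq_one {a b : ℝ} (ha : 0 < a) (hb : 0 < b) (hab : a + b = 1)
    {f g h : ℝ → ENNReal} (hf : Measurable f) (hg : Measurable g) (hh : Measurable h)
    (hf1 : ⨆ x, f x = 1) (hg1 : ⨆ x, g x = 1)
    (H : ∀ x y, f x ^ a * g y ^ b ≤ h (a * x + b * y)) :
    ENNReal.ofReal a * (∫⁻ x, f x) + ENNReal.ofReal b * (∫⁻ x, g x) ≤ ∫⁻ x, h x := by
  have hfle : ∀ x, f x ≤ 1 := fun x => hf1 ▸ le_iSup f x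
  have hgle : ∀ x, g x ≤ 1 := fun x => hg1 ▸ le_iSup g x
  -- Truncating `h` at 1 lets all three layer-cake integrals run over (0, 1).
  have hmin : ∫⁻ x, min (h x) 1 ≤ ∫⁻ x, h x := lintegral_mono fun x => min_le_left _ _
  refine le_trans ?_ hmin
  have hm : ∀ {u : ℝ → ENNReal}, Measurable u →
      Measurable fun t : ℝ => volume {x | ENNReal.ofReal t < u x} := fun {u} _ =>
    Antitone.measurable fun s t hst => measure_mono fun x hx =>
      (ENNReal.ofReal_le_ofReal hst).trans_lt hx
  rw [lintegral_eq_lintegral_Ioo_meas_lt hf hfle, lintegral_eq_lintegral_Ioo_meas_lt hg hgle,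
    lintegral_eq_lintegral_Ioo_meas_lt (hh.min measurable_const) (fun x => min_le_right _ _),
    ← lintegral_const_mul _ (hm hf), ← lintegral_const_mul _ (hm hg),
    ← lintegral_add_left ((hm hf).const_mul _)]
  refine setLIntegral_mono' measurableSet_Ioo fun t ht => ?_
  have ht1 : ENNReal.ofReal t < 1 := by simpa using ht.2
  have hsm : ∀ {c : ℝ}, 0 < c → ∀ s : Set ℝ, ENNReal.ofReal c * volume s = volume (c • s) := by
    intro c hc s
    rw [Measure.addHaar_smul]
    simp [abs_of_pos hc]
  rw [hsm ha, hsm hb]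
  have hfS : MeasurableSet {x | ENNReal.ofReal t < f x} := measurableSet_lt measurable_const hf
  have hgS : MeasurableSet {x | ENNReal.ofReal t < g x} := measurableSet_lt measurable_const hg
  refine volume_add_volume_le_of_add_subset (hfS.const_smul_of_ne_zero ha.ne')
    (hgS.const_smul_of_ne_zero hb.ne') ?_ ?_ ?_
  · obtain ⟨x, hx⟩ := lt_iSup_iff.1 (hf1 ▸ ht1)
    exact ⟨_, smul_mem_smul_set hx⟩
  · obtain ⟨x, hx⟩ := lt_iSup_iff.1 (hg1 ▸ ht1)
    exact ⟨_, smul_mem_smul_set hx⟩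
  · rintro _ ⟨_, ⟨x, hx, rfl⟩, _, ⟨y, hy, rfl⟩, rfl⟩
    simp only [mem_ofPred_eq, smul_eq_mul, lt_min_iff] at hx hy ⊢
    refine ⟨lt_of_lt_of_le ?_ (H x y), ht1⟩
    have ht0 : ENNReal.ofReal t ≠ 0 := by simpa using ht.1
    calc ENNReal.ofReal t = ENNReal.ofReal t ^ a * ENNReal.ofReal t ^ b := by
          rw [← ENNReal.rpow_add _ _ ht0 ENNReal.ofReal_ne_top, hab, ENNReal.rpow_one]
      _ < f x ^ a * g y ^ b :=
          ENNReal.mul_lt_mul (ENNReal.rpow_lt_rpow hx ha) (ENNReal.rpow_lt_rpow hy hb)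

/-- Dividing by the suprema reduces to the normalised case; the weighted AM–GM inequality makes the
result multiplicative, and the normalising constants cancel. -/
theorem prekopaLeindler_real_of_bounded {a b : ℝ} (ha : 0 < a) (hb : 0 < b) (hab : a + b = 1)
    {f g h : ℝ → ENNReal} (hf : Measurable f) (hg : Measurable g) (hh : Measurable h)
    (hft : ⨆ x, f x ≠ ⊤) (hgt : ⨆ x, g x ≠ ⊤)
    (H : ∀ x y, f x ^ a * g y ^ b ≤ h (a * x + b * y)) :
    (∫⁻ x, f x) ^ a * (∫⁻ x, g x) ^ b ≤ ∫⁻ x, h x := by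
  set F := ⨆ x, f x with hF
  set G := ⨆ x, g x with hG
  rcases eq_or_ne F 0 with hF0 | hF0
  · have : ∀ x, f x = 0 := by simpa [hF, ENNReal.iSup_eq_zero] using hF0
    simp [this, ha]
  rcases eq_or_ne G 0 with hG0 | hG0
  · have : ∀ x, g x = 0 := by simpa [hG, ENNReal.iSup_eq_zero] using hG0
    simp [this, hb]
  have hFa0 : F ^ a ≠ 0 := by simp [ENNReal.rpow_eq_zero_iff, hF0, hft]
  have hGb0 : G ^ b ≠ 0 := by simp [ENNReal.rpow_eq_zero_iff, hG0, hgt]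
  have hFat : F ^ a ≠ ⊤ := ENNReal.rpow_ne_top_of_nonneg ha.le hft
  have hGbt : G ^ b ≠ ⊤ := ENNReal.rpow_ne_top_of_nonneg hb.le hgt
  have key := prekopaLeindler_real_of_iSup_eq_one ha hb hab (hf.const_mul F⁻¹) (hg.const_mul G⁻¹)
    (hh.const_mul (F ^ a * G ^ b)⁻¹)
    (by rw [← ENNReal.mul_iSup, ENNReal.inv_mul_cancel hF0 hft])
    (by rw [← ENNReal.mul_iSup, ENNReal.inv_mul_cancel hG0 hgt])
    (fun x y => by
      rw [ENNReal.mul_rpow_of_nonneg _ _ ha.le, ENNReal.mul_rpow_of_nonneg _ _ hb.le,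
        ENNReal.mul_inv (Or.inl hFa0) (Or.inl hFat), ENNReal.inv_rpow, ENNReal.inv_rpow,
        mul_mul_mul_comm]
      gcongr
      exact H x y)
  have key2 := (ENNReal.rpow_mul_rpow_le_add ha hb hab _ _).trans key
  rw [lintegral_const_mul _ hf, lintegral_const_mul _ hg, lintegral_const_mul _ hh,
    ENNReal.mul_rpow_of_nonneg _ _ ha.le, ENNReal.mul_rpow_of_nonneg _ _ hb.le, mul_mul_mul_comm,
    ENNReal.inv_rpow, ENNReal.inv_rpow, ← ENNReal.mul_inv (Or.inl hFa0) (Or.inl hFat)] at key2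
  exact (ENNReal.mul_le_mul_iff_right (by simp [hFat, hGbt, ENNReal.mul_eq_top])
    (by simp [hFa0, hGb0])).1 key2

/-- One-dimensional Prékopa–Leindler inequality. -/
theorem prekopaLeindler_real {a b : ℝ} (ha : 0 < a) (hb : 0 < b) (hab : a + b = 1)
    {f g h : ℝ → ENNReal} (hf : Measurable f) (hg : Measurable g) (hh : Measurable h)
    (H : ∀ x y, f x ^ a * g y ^ b ≤ h (a * x + b * y)) :
    (∫⁻ x, f x) ^ a * (∫⁻ x, g x) ^ b ≤ ∫⁻ x, h x := by
  -- Zero integrals are set aside because the limit of the truncations below must avoid the product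
  -- 0 · ∞.
  rcases eq_or_ne (∫⁻ x, f x) 0 with hf0 | hf0
  · simp [hf0, ha]
  rcases eq_or_ne (∫⁻ x, g x) 0 with hg0 | hg0
  · simp [hg0, hb]
  have hlim : ∀ {u : ℝ → ENNReal}, Measurable u →
      Filter.Tendsto (fun n : ℕ => ∫⁻ x, min (u x) n) Filter.atTop (nhds (∫⁻ x, u x)) := by
    intro u hu
    refine lintegral_tendsto_of_tendsto_of_monotone
      (fun n => (hu.min measurable_const).aemeasurable) (Filter.Eventually.of_forall fun x => ?_)
      (Filter.Eventually.of_forall fun x => ?_)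
    · intro m n hmn
      exact min_le_min_left _ (by exact_mod_cast hmn)
    · have := (tendsto_const_nhds (x := u x)).min ENNReal.tendsto_nat_nhds_top
      simpa using this
  have hbd : ∀ (u : ℝ → ENNReal) (n : ℕ), ⨆ x, min (u x) n ≠ ⊤ := fun u n =>
    ((iSup_le fun x => min_le_right _ _).trans_lt (ENNReal.natCast_lt_top n)).ne
  refine le_of_tendsto' (ENNReal.Tendsto.mul ((ENNReal.continuous_rpow_const.tendsto _).comp
    (hlim hf)) (Or.inl ?_) ((ENNReal.continuous_rpow_const.tendsto _).comp (hlim hg)) (Or.inl ?_))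
    fun n => prekopaLeindler_real_of_bounded ha hb hab (hf.min measurable_const)
      (hg.min measurable_const) hh (hbd f n) (hbd g n) fun x y => le_trans ?_ (H x y)
  · simp [ENNReal.rpow_eq_zero_iff, hf0, not_lt.2 ha.le]
  · simp [ENNReal.rpow_eq_zero_iff, hg0, not_lt.2 hb.le]
  · gcongr <;> exact min_le_left _ _

/-- The Prékopa–Leindler inequality. -/
theorem prekopaLeindler {a b : ℝ} (ha : 0 < a) (hb : 0 < b) (hab : a + b = 1) (n : ℕ)
    {f g h : (Fin n → ℝ) → ENNReal} (hf : Measurable f) (hg : Measurable g) (hh : Measurable h)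
    (H : ∀ x y, f x ^ a * g y ^ b ≤ h (a • x + b • y)) :
    (∫⁻ x, f x) ^ a * (∫⁻ x, g x) ^ b ≤ ∫⁻ x, h x := by
  induction n with
  | zero =>
    have hv : (volume : Measure (Fin 0 → ℝ)) = Measure.dirac 0 := by
      rw [volume_pi, Measure.pi_of_empty _ 0]
    simp only [hv, lintegral_dirac]
    simpa using H 0 0
  | succ n ih =>
    have hcoe : ∀ p : ℝ × (Fin n → ℝ),
        (MeasurableEquiv.piFinSuccAbove (fun _ : Fin (n + 1) => ℝ) 0).symm p =
          Fin.cons p.1 p.2 := fun p => by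
      simp [MeasurableEquiv.piFinSuccAbove, Fin.insertNthEquiv]
    have hsplit : ∀ {u : (Fin (n + 1) → ℝ) → ENNReal}, Measurable u →
        ∫⁻ x, u x = ∫⁻ s : ℝ, ∫⁻ y : Fin n → ℝ, u (Fin.cons s y) := by
      intro u hu
      have he := (volume_preserving_piFinSuccAbove (fun _ : Fin (n + 1) => ℝ) 0).symm
      rw [← he.lintegral_comp hu, Measure.volume_eq_prod, lintegral_prod]
      · simp only [hcoe]
      · exact (hu.comp he.measurable).aemeasurable
    have hcons : Measurable fun p : ℝ × (Fin n → ℝ) => (Fin.cons p.1 p.2 : Fin (n + 1) → ℝ) := by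
      simp only [← hcoe]
      exact (MeasurableEquiv.piFinSuccAbove (fun _ : Fin (n + 1) => ℝ) 0).symm.measurable
    have hmeas : ∀ {u : (Fin (n + 1) → ℝ) → ENNReal}, Measurable u →
        Measurable fun s : ℝ => ∫⁻ y : Fin n → ℝ, u (Fin.cons s y) := fun {u} hu =>
      (hu.comp hcons).lintegral_prod_right'
    have hsec : ∀ {u : (Fin (n + 1) → ℝ) → ENNReal}, Measurable u → ∀ s : ℝ,
        Measurable fun y : Fin n → ℝ => u (Fin.cons s y) := fun {u} hu s =>
      (hu.comp hcons).comp measurable_prodMk_left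
    rw [hsplit hf, hsplit hg, hsplit hh]
    -- The induction hypothesis on the sections at `s` and `t` is precisely the one-dimensional
    -- hypothesis for the marginals.
    refine prekopaLeindler_real ha hb hab (hmeas hf) (hmeas hg) (hmeas hh) fun s t =>
      ih (hsec hf s) (hsec hg t) (hsec hh _) fun x y => ?_
    convert H (Fin.cons s x) (Fin.cons t y) using 2
    ext i
    refine Fin.cases ?_ (fun j => ?_) i <;> simp

/-- The multiplicative Brunn–Minkowski inequality. -/
theorem volume_rpow_mul_volume_rpow_le {n : ℕ} {a b : ℝ} (ha : 0 < a) (hb : 0 < b)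
    (hab : a + b = 1) {A B C : Set (EuclideanSpace ℝ (Fin n))} (hA : MeasurableSet A)
    (hB : MeasurableSet B) (hC : MeasurableSet C)
    (H : ∀ x ∈ A, ∀ y ∈ B, a • x + b • y ∈ C) :
    volume A ^ a * volume B ^ b ≤ volume C := by
  have e := PiLp.volume_preserving_toLp (Fin n)
  have hpre : ∀ {S : Set (EuclideanSpace ℝ (Fin n))}, MeasurableSet S → volume S =
      ∫⁻ x : Fin n → ℝ, (WithLp.toLp 2 ⁻¹' S).indicator (fun _ => (1 : ENNReal)) x := by
    intro S hS
    rw [lintegral_indicator (e.measurable hS), setLIntegral_one, e.measure_preimage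
      hS.nullMeasurableSet]
  have hm : ∀ {S : Set (EuclideanSpace ℝ (Fin n))}, MeasurableSet S →
      Measurable ((WithLp.toLp 2 ⁻¹' S).indicator fun _ : Fin n → ℝ => (1 : ENNReal)) :=
    fun hS => measurable_const.indicator (e.measurable hS)
  rw [hpre hA, hpre hB, hpre hC]
  refine prekopaLeindler ha hb hab n (hm hA) (hm hB) (hm hC) fun x y => ?_
  by_cases hx : WithLp.toLp 2 x ∈ A
  · by_cases hy : WithLp.toLp 2 y ∈ B
    · have := H _ hx _ hy
      rw [Set.indicator_of_mem (by simpa using hx), Set.indicator_of_mem (by simpa using hy),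
        Set.indicator_of_mem (by simpa using this)]
      simp
    · rw [Set.indicator_of_notMem (s := WithLp.toLp 2 ⁻¹' B) (by simpa using hy)]
      simp [hb]
  · rw [Set.indicator_of_notMem (s := WithLp.toLp 2 ⁻¹' A) (by simpa using hx)]
    simp [ha]

/-! ### Log-concave tails: density bound and Grünbaum's inequality -/

/-- Log-concavity of a real function, in multiplicative form. -/
def IsLogConcave (F : ℝ → ℝ) : Prop :=
  ∀ ⦃a b : ℝ⦄, 0 < a → 0 < b → a + b = 1 → ∀ s t : ℝ, F s ^ a * F t ^ b ≤ F (a * s + b * t)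

/-- Since F ≤ 1, an additive drop by q is at least a multiplicative drop by exp(-q). Thus log F has
average slope at most -q/h on [s, s + h], and concavity keeps it at most that steep-downward bound
further right. -/
theorem IsLogConcave.le_exp_of_le_sub {F : ℝ → ℝ} (hF : IsLogConcave F) (h0 : ∀ t, 0 ≤ F t)
    (h1 : ∀ t, F t ≤ 1) {s h q : ℝ} (hh : 0 < h) (hq : 0 ≤ q) (hs : F (s + h) ≤ F s - q) {u : ℝ}
    (hu : 0 < u) : F (s + h + u) ≤ Real.exp (-(q / h) * u) := by
  have ha : 0 < u / (h + u) := by positivity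
  have hb : 0 < h / (h + u) := by positivity
  have hab : u / (h + u) + h / (h + u) = 1 := by field_simp; ring
  have key := hF ha hb hab s (s + h + u)
  have hst : u / (h + u) * s + h / (h + u) * (s + h + u) = s + h := by field_simp; ring
  rw [hst] at key
  set a := u / (h + u) with ha_def
  set b := h / (h + u) with hb_def
  rcases (h0 s).eq_or_lt with hs0 | hs0
  · have : q = 0 := by have := h0 (s + h); linarith
    simpa [this] using h1 _
  have hle : F s - q ≤ F s * Real.exp (-q) := by
    have h2 := Real.add_one_le_exp (-q)
    have h3 : F s * (-q + 1) ≤ F s * Real.exp (-q) := by gcongr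
    have h4 : F s * q ≤ 1 * q := by gcongr; exact h1 s
    linarith
  have hsplit : F s = F s ^ a * F s ^ b := by
    rw [← Real.rpow_add hs0, hab, Real.rpow_one]
  have hpow : F (s + h + u) ^ b ≤ Real.exp (-q) := by
    have h5 : F s ^ a * F (s + h + u) ^ b ≤ F s ^ a * (F s ^ b * Real.exp (-q)) := by
      rw [← mul_assoc, ← hsplit]; linarith
    have h6 := le_of_mul_le_mul_left h5 (Real.rpow_pos_of_pos hs0 a)
    have h7 : F s ^ b ≤ 1 := Real.rpow_le_one hs0.le (h1 s) hb.le
    have h8 : F s ^ b * Real.exp (-q) ≤ 1 * Real.exp (-q) := by gcongr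
    linarith
  have hexp : Real.exp (-q) = Real.exp (-q / b) ^ b := by
    rw [← Real.exp_mul, div_mul_cancel₀ _ hb.ne']
  rw [hexp, Real.rpow_le_rpow_iff (h0 _) (Real.exp_pos _).le hb] at hpow
  refine hpow.trans (Real.exp_le_exp.2 ?_)
  have : -q / b = -(q / h) * u - q := by rw [hb_def]; field_simp; ring
  linarith

/-- The second moment of the positive part is 2 ∫ u P(Y ≥ u) du, which is compared with a Gamma
integral. -/
theorem lintegral_sq_posPart_le_of_measure_le_exp {Ω : Type*} [MeasurableSpace Ω] {μ : Measure Ω}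
    [IsFiniteMeasure μ] {Y : Ω → ℝ} (hY : Measurable Y) {κ : ℝ} (hκ : 0 < κ)
    (h : ∀ u, 0 < u → μ.real {x | u ≤ Y x} ≤ Real.exp (-κ * u)) :
    ∫⁻ x, ENNReal.ofReal (max (Y x) 0 ^ 2) ∂μ ≤ ENNReal.ofReal (2 / κ ^ 2) := by
  have h1 := lintegral_rpow_eq_lintegral_meas_le_mul μ (f := fun x => max (Y x) 0)
    (Filter.Eventually.of_forall fun x => le_max_right _ _)
    (hY.max measurable_const).aemeasurable (p := 2) two_pos
  simp only [Real.rpow_ofNat] at h1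
  rw [h1]
  have h2 : ∫⁻ t in Set.Ioi (0 : ℝ), μ {x | t ≤ max (Y x) 0} * ENNReal.ofReal (t ^ ((2 : ℝ) - 1)) ≤
      ∫⁻ t in Set.Ioi (0 : ℝ), ENNReal.ofReal (t ^ ((2 : ℝ) - 1) * Real.exp (-(κ * t))) := by
    refine setLIntegral_mono' measurableSet_Ioi fun t (ht : 0 < t) => ?_
    have hset : {x | t ≤ max (Y x) 0} = {x | t ≤ Y x} := by
      ext x
      simp [not_le.2 ht]
    rw [hset, mul_comm, ENNReal.ofReal_mul (by positivity)]
    gcongr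
    rw [← ofReal_measureReal]
    refine ENNReal.ofReal_le_ofReal ((h t ht).trans_eq ?_)
    rw [neg_mul]
  have h3 := Real.integral_rpow_mul_exp_neg_mul_Ioi (a := 2) (r := κ) two_pos hκ
  have hint : IntegrableOn (fun t : ℝ => t ^ ((2 : ℝ) - 1) * Real.exp (-(κ * t)))
      (Set.Ioi 0) := by
    -- A non-integrable function has integral 0 by convention, whereas the Gamma formula gives a
    -- positive value.
    by_contra hc
    rw [integral_undef hc] at h3
    have : Real.Gamma 2 = 1 := Real.Gamma_two
    rw [this, mul_one] at h3
    have : 0 < (1 / κ) ^ (2 : ℝ) := by positivity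
    linarith
  rw [← ofReal_integral_eq_lintegral_ofReal hint (by
    filter_upwards [ae_restrict_mem measurableSet_Ioi] with t (ht : 0 < t)
    positivity), h3, Real.Gamma_two] at h2
  refine (mul_le_mul_right h2 _).trans_eq ?_
  rw [← ENNReal.ofReal_mul two_pos.le]
  congr 1
  rw [Real.rpow_ofNat]
  field_simp

/-- A random variable with log-concave tails has density at most a constant over its standard
deviation. -/
theorem variance_mul_sq_le_of_isLogConcave {Ω : Type*} [MeasurableSpace Ω] {μ : Measure Ω}
    [IsProbabilityMeasure μ] {X : Ω → ℝ} (hX : Measurable X)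
    (hF : IsLogConcave fun t => μ.real {x | t ≤ X x})
    (hG : IsLogConcave fun t => μ.real {x | t ≤ -X x}) (s : ℝ) {h : ℝ} (hh : 0 < h) :
    Var[X; μ] * μ.real {x | s < X x ∧ X x < s + h} ^ 2 ≤ 8 * h ^ 2 := by
  set q := μ.real {x | s < X x ∧ X x < s + h} with hq
  have hq0 : 0 ≤ q := measureReal_nonneg
  have hq1 : q ≤ 1 := measureReal_le_one
  rcases hq0.eq_or_lt with hz | hqpos
  · rw [← hz]; simp; positivity
  have hSm : MeasurableSet {x | s < X x ∧ X x < s + h} :=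
    (measurableSet_lt measurable_const hX).inter (measurableSet_lt hX measurable_const)
  have hright : ∀ u, 0 < u → μ.real {x | u ≤ X x - (s + h)} ≤ Real.exp (-(q / h) * u) := by
    intro u hu
    have h1 : μ.real {x | s + h ≤ X x} ≤ μ.real {x | s ≤ X x} - q := by
      rw [le_sub_iff_add_le, hq, ← measureReal_union _ hSm]
      · refine measureReal_mono ?_
        rintro x (hx | hx)
        · exact (by linarith : s ≤ s + h).trans hx
        · exact hx.1.le
      · rw [Set.disjoint_left]
        intro x hx hx'
        exact absurd hx'.2 (not_lt.2 hx)
    have h2 := hF.le_exp_of_le_sub (fun _ => measureReal_nonneg) (fun _ => measureReal_le_one) hh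
      hq0 h1 hu
    simpa only [le_sub_iff_add_le, add_comm u] using h2
  have hleft : ∀ u, 0 < u → μ.real {x | u ≤ s - X x} ≤ Real.exp (-(q / h) * u) := by
    intro u hu
    have h1 : μ.real {x | -(s + h) + h ≤ -X x} ≤ μ.real {x | -(s + h) ≤ -X x} - q := by
      rw [le_sub_iff_add_le, hq, ← measureReal_union _ hSm]
      · refine measureReal_mono ?_
        rintro x (hx | hx)
        · exact (by linarith : -(s + h) ≤ -(s + h) + h).trans hx
        · exact (neg_le_neg hx.2.le :)
      · rw [Set.disjoint_left]
        intro x (hx : -(s + h) + h ≤ -X x) hx'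
        linarith [hx'.1]
    have h2 := hG.le_exp_of_le_sub (fun _ => measureReal_nonneg) (fun _ => measureReal_le_one) hh
      hq0 h1 hu
    have hset : {x | u ≤ s - X x} = {x | -(s + h) + h + u ≤ -X x} := by
      ext x
      simp only [Set.mem_ofPred_eq]
      constructor <;> intro hx <;> linarith
    rw [hset]
    exact h2
  have hκ : 0 < q / h := by positivity
  have hR := lintegral_sq_posPart_le_of_measure_le_exp (hX.sub_const (s + h)) hκ hright
  have hL := lintegral_sq_posPart_le_of_measure_le_exp (hX.const_sub s) hκ hleft
  -- The variance is at most the second moment about s, and (X - s)² ≤ 2h² + 2((X - s - h)⁺)² + ((s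
  -- - X)⁺)². The tails contribute 6h²/q² and, as q ≤ 1, the first term at most 2h²/q²; hence the
  -- constant 8.
  have hV : ENNReal.ofReal Var[X; μ] ≤ ENNReal.ofReal (8 * h ^ 2 / q ^ 2) := by
    have hv : Var[X; μ] ≤ ∫ x, (X x - s) ^ 2 ∂μ := by
      rw [← variance_sub_const hX.aestronglyMeasurable s]
      exact variance_le_expectation_sq (hX.sub_const s).aestronglyMeasurable
    calc ENNReal.ofReal Var[X; μ] ≤ ENNReal.ofReal (∫ x, (X x - s) ^ 2 ∂μ) :=
          ENNReal.ofReal_le_ofReal hv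
      _ ≤ ∫⁻ x, ENNReal.ofReal ((X x - s) ^ 2) ∂μ := by
          rw [integral_eq_lintegral_of_nonneg_ae (Filter.Eventually.of_forall fun x => sq_nonneg _)
            ((hX.sub_const s).pow_const 2).aestronglyMeasurable]
          exact ENNReal.ofReal_toReal_le
      _ ≤ ∫⁻ x, (ENNReal.ofReal (2 * h ^ 2) + (2 * ENNReal.ofReal (max (X x - (s + h)) 0 ^ 2) +
            ENNReal.ofReal (max (s - X x) 0 ^ 2))) ∂μ := by
          refine lintegral_mono fun x => ?_
          have h2 : (2 : ENNReal) = ENNReal.ofReal 2 := by simp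
          rw [h2, ← ENNReal.ofReal_mul two_pos.le, ← ENNReal.ofReal_add (by positivity)
            (by positivity), ← ENNReal.ofReal_add (by positivity) (by positivity)]
          refine ENNReal.ofReal_le_ofReal ?_
          rcases le_total (X x) s with hc | hc
          · rw [max_eq_left (by linarith : 0 ≤ s - X x)]
            nlinarith [sq_nonneg h, sq_nonneg (max (X x - (s + h)) 0)]
          · rcases le_total (X x) (s + h) with hd | hd
            · nlinarith [sq_nonneg (max (X x - (s + h)) 0), sq_nonneg (max (s - X x) 0)]
            · rw [max_eq_left (by linarith : 0 ≤ X x - (s + h))]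
              nlinarith [sq_nonneg (X x - s - 2 * h), sq_nonneg (max (s - X x) 0)]
      _ = ENNReal.ofReal (2 * h ^ 2) + (2 * ∫⁻ x, ENNReal.ofReal (max (X x - (s + h)) 0 ^ 2) ∂μ +
            ∫⁻ x, ENNReal.ofReal (max (s - X x) 0 ^ 2) ∂μ) := by
          rw [lintegral_add_left measurable_const, lintegral_const, measure_univ, mul_one,
            lintegral_add_left (by fun_prop), lintegral_const_mul _ (by fun_prop)]
      _ ≤ ENNReal.ofReal (2 * h ^ 2) + (2 * ENNReal.ofReal (2 / (q / h) ^ 2) +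
            ENNReal.ofReal (2 / (q / h) ^ 2)) := by gcongr
      _ ≤ ENNReal.ofReal (8 * h ^ 2 / q ^ 2) := by
          have h2 : (2 : ENNReal) = ENNReal.ofReal 2 := by simp
          rw [h2, ← ENNReal.ofReal_mul two_pos.le, ← ENNReal.ofReal_add (by positivity)
            (by positivity), ← ENNReal.ofReal_add (by positivity) (by positivity)]
          refine ENNReal.ofReal_le_ofReal ?_
          have h3 : 2 * h ^ 2 ≤ 2 * h ^ 2 / q ^ 2 := by
            rw [le_div_iff₀ (by positivity)]
            have : q ^ 2 ≤ 1 := pow_le_one₀ hq0 hq1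
            nlinarith [sq_nonneg h]
          have h4 : 2 * (2 / (q / h) ^ 2) + 2 / (q / h) ^ 2 = 6 * (h ^ 2 / q ^ 2) := by
            field_simp; ring
          rw [h4]
          have : 8 * h ^ 2 / q ^ 2 = 2 * h ^ 2 / q ^ 2 + 6 * (h ^ 2 / q ^ 2) := by ring
          linarith
  rw [ENNReal.ofReal_le_ofReal_iff (by positivity), le_div_iff₀ (by positivity)] at hV
  exact hV

/-- This is a supporting line of the concave function log G at 0: some -a separates the slopes of
chords to the right of 0 from those to the left. Points with G = 0 are left out on the right,
because `Real.log 0 = 0` would give a wrong slope. -/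
theorem IsLogConcave.exists_le_mul_exp {G : ℝ → ℝ} (hG : IsLogConcave G) (hanti : Antitone G)
    (h0 : ∀ t, 0 ≤ G t) {v : ℝ} (hv : 0 < v) (hGv : 0 < G v) :
    ∃ a, 0 ≤ a ∧ ∀ t, G t ≤ G 0 * Real.exp (-a * t) := by
  have hp : 0 < G 0 := hGv.trans_le (hanti hv.le)
  have hslope : ∀ x ∈ {y | ∃ v, 0 < v ∧ 0 < G v ∧ y = (Real.log (G v) - Real.log (G 0)) / v},
      ∀ y ∈ {y | ∃ u, 0 < u ∧ y = (Real.log (G 0) - Real.log (G (-u))) / u}, x ≤ y := by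
    rintro _ ⟨v, hv, hGv, rfl⟩ _ ⟨u, hu, rfl⟩
    have hGu : 0 < G (-u) := hp.trans_le (hanti (by linarith))
    have h1 := hG (a := v / (u + v)) (b := u / (u + v)) (by positivity) (by positivity)
      (by field_simp; ring) (-u) v
    have h2 : v / (u + v) * -u + u / (u + v) * v = 0 := by ring
    rw [h2] at h1
    have h3 := Real.log_le_log (by positivity) h1
    rw [Real.log_mul (by positivity) (by positivity), Real.log_rpow hGu, Real.log_rpow hGv] at h3
    rw [div_le_div_iff₀ hv hu]
    have h4 : (v / (u + v) * Real.log (G (-u)) + u / (u + v) * Real.log (G v)) * (u + v) ≤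
        Real.log (G 0) * (u + v) := by gcongr
    have h5 : (v / (u + v) * Real.log (G (-u)) + u / (u + v) * Real.log (G v)) * (u + v) =
        v * Real.log (G (-u)) + u * Real.log (G v) := by field_simp
    linarith
  have hex := fun h₁ h₂ => exists_between_of_forall_le h₁ h₂ hslope
  obtain ⟨c, hc1, hc2⟩ := hex ⟨_, v, hv, hGv, rfl⟩ ⟨_, 1, one_pos, rfl⟩
  refine ⟨-c, ?_, fun t => ?_⟩
  · have h1 := hc2 ⟨1, one_pos, rfl⟩
    have h2 := Real.log_le_log hp (hanti (by norm_num : (-1 : ℝ) ≤ 0))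
    rw [div_one] at h1
    linarith
  · rcases (h0 t).eq_or_lt with ht0 | ht0
    · rw [← ht0]; positivity
    · rw [← Real.log_le_log_iff ht0 (by positivity), Real.log_mul hp.ne' (Real.exp_pos _).ne',
        Real.log_exp, neg_neg]
      rcases lt_trichotomy t 0 with ht | rfl | ht
      · have h1 := hc2 ⟨-t, by linarith, rfl⟩
        rw [le_div_iff₀ (by linarith), neg_neg] at h1
        linarith
      · simp
      · have h1 := hc1 ⟨t, ht, ht0, rfl⟩
        rw [div_le_iff₀ ht] at h1
        linarith

/-- Grünbaum's inequality for bounded random variables with log-concave tails. -/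
theorem exp_neg_one_le_measureReal_of_isLogConcave {Ω : Type*} [MeasurableSpace Ω] {μ : Measure Ω}
    [IsProbabilityMeasure μ] {X : Ω → ℝ} (hX : Measurable X) {R : ℝ} (hR : ∀ᵐ x ∂μ, |X x| ≤ R)
    (hmean : ∫ x, X x ∂μ = 0) (hG : IsLogConcave fun t => μ.real {x | t ≤ X x}) :
    Real.exp (-1) ≤ μ.real {x | 0 ≤ X x} := by
  have hint : Integrable X μ := Integrable.of_bound hX.aestronglyMeasurable R hR
  set G : ℝ → ℝ := fun t => μ.real {x | t ≤ X x} with hGdef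
  have hanti : Antitone G := fun s t hst => measureReal_mono fun x hx => hst.trans hx
  have hG0 : ∀ t, 0 ≤ G t := fun t => measureReal_nonneg
  have hG1 : ∀ t, G t ≤ 1 := fun t => measureReal_le_one
  by_cases hv : ∃ v, 0 < v ∧ 0 < G v
  swap
  -- Without mass on the positive side, the zero mean forces X = 0 almost everywhere.
  · have hle : ∀ᵐ x ∂μ, X x ≤ 0 := by
      have hn : ∀ n : ℕ, ∀ᵐ x ∂μ, X x < 1 / ((n : ℝ) + 1) := by
        intro n
        have h1 : G (1 / ((n : ℝ) + 1)) = 0 := by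
          by_contra hne
          exact hv ⟨_, by positivity, (hG0 _).lt_of_ne' hne⟩
        rw [hGdef, measureReal_eq_zero_iff] at h1
        rw [ae_iff]
        simpa using h1
      filter_upwards [ae_all_iff.2 hn] with x hx
      exact ge_of_tendsto' tendsto_one_div_add_atTop_nhds_zero_nat fun n => (hx n).le
    have hzero : ∀ᵐ x ∂μ, -X x = 0 := by
      have := (integral_eq_zero_iff_of_nonneg_ae (f := fun x => -X x) (μ := μ)
        (by filter_upwards [hle] with x hx; simpa using hx) hint.neg).1
        (by rw [integral_neg, hmean, neg_zero])
      exact this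
    have hone : μ.real {x | 0 ≤ X x} = 1 := by
      have : ∀ᵐ x ∂μ, 0 ≤ X x := by filter_upwards [hzero] with x hx; linarith
      rw [measureReal_def, (prob_compl_eq_zero_iff (measurableSet_le measurable_const hX)).1 this]
      simp
    rw [hone]
    exact Real.exp_le_one_iff.2 (by norm_num)
  obtain ⟨v, hv, hGv⟩ := hv
  have hp : 0 < G 0 := hGv.trans_le (hanti hv.le)
  obtain ⟨a, ha0, ha⟩ := hG.exists_le_mul_exp hanti hG0 hv hGv
  have hGR : G (-R) = 1 := by
    have : ∀ᵐ x ∂μ, -R ≤ X x := by filter_upwards [hR] with x hx; exact (abs_le.1 hx).1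
    change μ.real {x | -R ≤ X x} = 1
    rw [measureReal_def, (prob_compl_eq_zero_iff (measurableSet_le measurable_const hX)).1 this]
    simp
  change Real.exp (-1) ≤ G 0
  have haR := ha (-R)
  rw [hGR] at haR
  rcases ha0.eq_or_lt with rfl | hapos
  · simp only [neg_zero, zero_mul, Real.exp_zero, mul_one] at haR
    exact (Real.exp_le_one_iff.2 (by norm_num)).trans haR
  have hlogc : 0 ≤ Real.log (G 0) + a * R := by
    have := Real.log_nonneg haR
    rwa [Real.log_mul hp.ne' (Real.exp_pos _).ne', Real.log_exp, neg_mul_neg] at this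
  -- At u₀ - R the exponential bound G(0) exp(-at) equals 1. Bounding the tail by 1 before it and by
  -- the exponential after it gives R = E[X + R] ≤ u₀ + 1/a, which rearranges to log G(0) ≥ -1.
  set u₀ := (Real.log (G 0) + a * R) / a with hu₀
  have hu₀0 : 0 ≤ u₀ := by positivity
  have hbound : ENNReal.ofReal R ≤ ENNReal.ofReal (u₀ + 1 / a) := by
    calc ENNReal.ofReal R = ENNReal.ofReal (∫ x, (X x + R) ∂μ) := by
          rw [integral_add hint (integrable_const _), hmean]; simp
      _ = ∫⁻ x, ENNReal.ofReal (X x + R) ∂μ :=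
          ofReal_integral_eq_lintegral_ofReal (hint.add (integrable_const _)) (by
            filter_upwards [hR] with x hx
            have := (abs_le.1 hx).1
            change 0 ≤ X x + R
            linarith)
      _ = ∫⁻ u in Set.Ioi (0 : ℝ), μ {x | u ≤ X x + R} :=
          lintegral_eq_lintegral_meas_le μ (by
            filter_upwards [hR] with x hx
            have := (abs_le.1 hx).1
            change 0 ≤ X x + R
            linarith) (hX.add_const R).aemeasurable
      _ ≤ ∫⁻ u in Set.Ioc 0 u₀ ∪ Set.Ioi u₀, μ {x | u ≤ X x + R} := by
          rw [Set.Ioc_union_Ioi_eq_Ioi hu₀0]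
      _ ≤ (∫⁻ u in Set.Ioc 0 u₀, μ {x | u ≤ X x + R}) +
            ∫⁻ u in Set.Ioi u₀, μ {x | u ≤ X x + R} := lintegral_union_le _ _ _
      _ ≤ (∫⁻ u in Set.Ioc 0 u₀, 1) +
            ∫⁻ u in Set.Ioi u₀, ENNReal.ofReal (Real.exp (a * u₀) * Real.exp (-a * u)) := by
          refine add_le_add (lintegral_mono fun u => prob_le_one)
            (lintegral_mono fun u => ?_)
          have hset : {x | u ≤ X x + R} = {x | u - R ≤ X x} := by
            ext x; simp
          rw [hset, ← ofReal_measureReal]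
          refine ENNReal.ofReal_le_ofReal ((ha (u - R)).trans_eq ?_)
          rw [hu₀, mul_div_cancel₀ _ hapos.ne', Real.exp_add, Real.exp_log hp, mul_assoc,
            ← Real.exp_add]
          congr 2
          ring
      _ = ENNReal.ofReal u₀ + ENNReal.ofReal (1 / a) := by
          congr 1
          · simp
          · rw [← ofReal_integral_eq_lintegral_ofReal
              ((integrableOn_exp_mul_Ioi (by linarith : -a < 0) u₀).const_mul _)
              (Filter.Eventually.of_forall fun u => by positivity), integral_const_mul,
              integral_exp_mul_Ioi (by linarith : -a < 0) u₀]
            congr 1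
            rw [neg_mul, neg_div_neg_eq, mul_div_assoc', ← Real.exp_add, add_neg_cancel,
              Real.exp_zero]
      _ = ENNReal.ofReal (u₀ + 1 / a) := (ENNReal.ofReal_add hu₀0 (by positivity)).symm
  rw [ENNReal.ofReal_le_ofReal_iff (by positivity), hu₀, ← add_div, le_div_iff₀ hapos] at hbound
  rw [← Real.le_log_iff_exp_le hp]
  linarith

/-! ### Marginals and sections of convex bodies -/

theorem cond_volume_eq_restrict {d : ℕ} {K : Set (EuclideanSpace ℝ (Fin d))} (hK : volume K = 1) :
    cond volume K = volume.restrict K := by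
  simp [ProbabilityTheory.cond, hK]

theorem isProbabilityMeasure_restrict {d : ℕ} {K : Set (EuclideanSpace ℝ (Fin d))}
    (hK : volume K = 1) : IsProbabilityMeasure (volume.restrict K) :=
  ⟨by rw [Measure.restrict_apply_univ, hK]⟩

theorem IsCompact.memLp_restrict {d : ℕ} {K : Set (EuclideanSpace ℝ (Fin d))} (hK : IsCompact K)
    {F : Type*} [NormedAddCommGroup F] {f : EuclideanSpace ℝ (Fin d) → F} (hf : Continuous f)
    (p : ENNReal) : MemLp f p (volume.restrict K) := by
  have : IsFiniteMeasure (volume.restrict K) :=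
    ⟨by rw [Measure.restrict_apply_univ]; exact hK.measure_lt_top⟩
  obtain ⟨C, hC⟩ := (hK.image hf).isBounded.exists_norm_le
  exact MemLp.of_bound (hf.continuousOn.aestronglyMeasurable_of_isCompact hK hK.measurableSet)
    C ((ae_restrict_mem hK.measurableSet).mono fun x hx => hC _ ⟨x, hx, rfl⟩)

/-- Brunn–Minkowski applies to the parts of K cut off by parallel half-spaces: convex combinations
of their points stay in K and beyond the averaged level. -/
theorem Convex.isLogConcave_measureReal_le_inner {d : ℕ} {K : Set (EuclideanSpace ℝ (Fin d))}
    (hK : Convex ℝ K) (hKc : IsCompact K) (θ : EuclideanSpace ℝ (Fin d)) :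
    IsLogConcave fun t => (volume.restrict K).real {x | t ≤ inner ℝ x θ} := by
  intro a b ha hb hab s t
  have hm : ∀ t : ℝ, MeasurableSet {x : EuclideanSpace ℝ (Fin d) | t ≤ inner ℝ x θ} := fun t =>
    measurableSet_le measurable_const (by fun_prop)
  have hfin : ∀ S : Set (EuclideanSpace ℝ (Fin d)), volume (S ∩ K) ≠ ⊤ := fun S =>
    ((measure_mono Set.inter_subset_right).trans_lt hKc.measure_lt_top).ne
  have h := volume_rpow_mul_volume_rpow_le ha hb hab ((hm s).inter hKc.measurableSet)
    ((hm t).inter hKc.measurableSet) ((hm (a * s + b * t)).inter hKc.measurableSet) (by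
      rintro x ⟨hx, hxK⟩ y ⟨hy, hyK⟩
      refine ⟨?_, hK hxK hyK ha.le hb.le hab⟩
      simp only [Set.mem_ofPred_eq] at hx hy ⊢
      rw [inner_add_left, inner_smul_left, inner_smul_left]
      simp only [conj_trivial]
      gcongr)
  have h' := ENNReal.toReal_mono (hfin _) h
  rw [ENNReal.toReal_mul, ← ENNReal.toReal_rpow, ← ENNReal.toReal_rpow] at h'
  simpa only [measureReal_def, Measure.restrict_apply (hm _)] using h'

theorem Convex.isLogConcave_measureReal_le_neg_inner {d : ℕ}
    {K : Set (EuclideanSpace ℝ (Fin d))} (hK : Convex ℝ K) (hKc : IsCompact K)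
    (θ : EuclideanSpace ℝ (Fin d)) :
    IsLogConcave fun t => (volume.restrict K).real {x | t ≤ -inner ℝ x θ} := by
  simpa only [inner_neg_right] using hK.isLogConcave_measureReal_le_inner hKc (-θ)

theorem variance_inner_mul_sq_le {d : ℕ} {K : Set (EuclideanSpace ℝ (Fin d))}
    (hK : IsFullConvexBody K) (hv : volume K = 1) (θ : EuclideanSpace ℝ (Fin d)) (s : ℝ) {h : ℝ}
    (hh : 0 < h) :
    Var[fun x => inner ℝ x θ; volume.restrict K] *
      (volume.restrict K).real {x | s < inner ℝ x θ ∧ inner ℝ x θ < s + h} ^ 2 ≤ 8 * h ^ 2 := by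
  have := isProbabilityMeasure_restrict hv
  exact variance_mul_sq_le_of_isLogConcave (by fun_prop)
    (hK.1.isLogConcave_measureReal_le_inner hK.2.1 θ)
    (hK.1.isLogConcave_measureReal_le_neg_inner hK.2.1 θ) s hh

theorem IsIsotropic.exists_variance_inner_eq {d : ℕ} {K : Set (EuclideanSpace ℝ (Fin d))}
    (hK : IsFullConvexBody K) (hv : volume K = 1) (hiso : IsIsotropic K) :
    ∃ L : ℝ, 0 < L ∧ ∀ θ : EuclideanSpace ℝ (Fin d),
      Var[fun x => inner ℝ x θ; volume.restrict K] = L ^ 2 * ‖θ‖ ^ 2 := by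
  have := isProbabilityMeasure_restrict hv
  obtain ⟨-, L, hL, hcov⟩ := hiso
  rw [cond_volume_eq_restrict hv] at hcov
  refine ⟨L, hL, fun θ => ?_⟩
  have h1 := covarianceBilin_self (hK.2.1.memLp_restrict continuous_id 2) θ
  have h2 := covarianceBilin_apply_pi (μ := volume.restrict K)
    (X := fun (i : Fin d) (x : EuclideanSpace ℝ (Fin d)) => x i)
    (fun i => hK.2.1.memLp_restrict (by fun_prop) 2) θ θ
  have hid : (fun ω : EuclideanSpace ℝ (Fin d) => WithLp.toLp 2 fun x => ω x) = id := rfl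
  rw [hid, Measure.map_id, h1] at h2
  simp only [real_inner_comm θ]
  rw [h2, EuclideanSpace.real_norm_sq_eq, Finset.mul_sum]
  simp only [hcov, mul_ite, mul_zero, Finset.sum_ite_eq, Finset.mem_univ, if_true]
  exact Finset.sum_congr rfl fun i _ => by ring

theorem IsIsotropic.integral_inner_eq_zero {d : ℕ} {K : Set (EuclideanSpace ℝ (Fin d))}
    (hK : IsFullConvexBody K) (hv : volume K = 1) (hiso : IsIsotropic K)
    (θ : EuclideanSpace ℝ (Fin d)) : ∫ x, inner ℝ x θ ∂(volume.restrict K) = 0 := by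
  have := isProbabilityMeasure_restrict hv
  have h := hiso.1
  rw [cond_volume_eq_restrict hv] at h
  simp only [real_inner_comm θ]
  have hint : Integrable (fun x => x) (volume.restrict K) :=
    memLp_one_iff_integrable.1 (hK.2.1.memLp_restrict continuous_id 1)
  rw [integral_inner hint θ, h, inner_zero_right]

/-- Fubini's theorem for slabs, in terms of hyperplane sections. -/
theorem volume_restrict_slab {d : ℕ} {K : Set (EuclideanSpace ℝ (Fin d))} (hK : MeasurableSet K)
    {θ : EuclideanSpace ℝ (Fin d)} (hθ : ‖θ‖ = 1) (s u : ℝ) :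
    (volume.restrict K) {x | s < inner ℝ x θ ∧ inner ℝ x θ < u} =
      ∫⁻ t in Set.Ioo s u, μHE[d - 1] (hyperplane θ t ∩ K) := by
  have hm : MeasurableSet {x : EuclideanSpace ℝ (Fin d) | s < inner ℝ x θ ∧ inner ℝ x θ < u} :=
    MeasurableSet.inter (s₁ := {x | s < inner ℝ x θ}) (s₂ := {x | inner ℝ x θ < u})
      (measurableSet_lt measurable_const (by fun_prop))
      (measurableSet_lt (by fun_prop) measurable_const)
  have hθ0 : θ ≠ 0 := by rintro rfl; simp at hθ
  have h := EuclideanGeometry.euclideanHausdorffMeasure_eq_lintegral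
    (0 : EuclideanSpace ℝ (Fin d)) hθ0 (hm.inter hK)
  rw [finrank_euclideanSpace_fin, EuclideanSpace.euclideanHausdorffMeasure_eq_volume] at h
  have hθe : ‖θ‖ₑ = 1 := by rw [← ofReal_norm, hθ]; simp
  rw [Measure.restrict_apply hm, h, hθe, one_mul, ← lintegral_indicator measurableSet_Ioo]
  congr 1
  ext t
  have hsec : (AffineSubspace.mk' (t • θ +ᵥ (0 : EuclideanSpace ℝ (Fin d))) (ℝ ∙ θ)ᗮ :
      Set (EuclideanSpace ℝ (Fin d))) = hyperplane θ t := by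
    ext y
    simp only [SetLike.mem_coe, AffineSubspace.mem_mk', hyperplane, Set.mem_ofPred_eq,
      vadd_eq_add, add_zero, vsub_eq_sub, Submodule.mem_orthogonal_singleton_iff_inner_left,
      inner_sub_left, inner_smul_left, real_inner_self_eq_norm_sq, hθ, conj_trivial]
    constructor <;> intro hy <;> linarith
  rw [hsec]
  by_cases ht : t ∈ Set.Ioo s u
  · rw [Set.indicator_of_mem ht]
    congr 1
    ext y
    simp only [hyperplane, Set.mem_inter_iff, Set.mem_ofPred_eq]
    constructor
    · rintro ⟨⟨-, h2⟩, h3⟩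
      exact ⟨h3, h2⟩
    · rintro ⟨h3, h2⟩
      exact ⟨⟨h3 ▸ ht, h2⟩, h3⟩
  · rw [Set.indicator_of_notMem ht]
    convert measure_empty (μ := μHE[d - 1])
    ext y
    simp only [hyperplane, Set.mem_inter_iff, Set.mem_ofPred_eq, Set.mem_empty_iff_false, iff_false]
    rintro ⟨⟨h1, -⟩, h3⟩
    exact ht (h3 ▸ h1)

/-! ### From large sections to bounded isotropic variance -/

/-- The isotropic constants are bounded uniformly in the dimension: `C` bounds the variances of the
one-dimensional marginals of isotropic convex bodies of unit volume. -/
def IsotropicVarianceLE (C : ℝ) : Prop :=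
  ∀ d : ℕ, 1 ≤ d → ∀ K : Set (EuclideanSpace ℝ (Fin d)), IsFullConvexBody K → volume K = 1 →
    IsIsotropic K → ∀ θ : EuclideanSpace ℝ (Fin d), ‖θ‖ = 1 →
      Var[fun x => inner ℝ x θ; volume.restrict K] ≤ C

theorem IsFullConvexBody.exists_inner_ne {d : ℕ} {K : Set (EuclideanSpace ℝ (Fin d))}
    (hK : IsFullConvexBody K) {θ : EuclideanSpace ℝ (Fin d)} (hθ : ‖θ‖ = 1) (t : ℝ) :
    ∃ p ∈ interior K, inner ℝ p θ ≠ t := by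
  by_contra! hcon
  obtain ⟨x, hx⟩ := hK.2.2
  obtain ⟨ε, hε, hball⟩ := Metric.isOpen_iff.1 isOpen_interior x hx
  have h1 := hcon x hx
  have h2 := hcon (x + (ε / 2) • θ) (hball (by
    rw [mem_ball_iff_norm, add_sub_cancel_left, norm_smul, hθ, mul_one, Real.norm_eq_abs,
      abs_of_pos (by positivity)]
    linarith))
  rw [inner_add_left, inner_smul_left, real_inner_self_eq_norm_sq, hθ, h1, conj_trivial] at h2
  linarith

/-- The cone over the section with apex p lies in K, so slices at relative height w have area at
least (1 - w)^(d-1) c. A thin slab thus has nearly the mass of a cylinder over the section, and the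
density bound applies. The dimension-dependent factor disappears as the relative thickness r tends
to 0. -/
theorem variance_inner_le_of_le_section_of_lt {d : ℕ} {K : Set (EuclideanSpace ℝ (Fin d))}
    (hK : IsFullConvexBody K) (hv : volume K = 1) {θ : EuclideanSpace ℝ (Fin d)} (hθ : ‖θ‖ = 1)
    {t c : ℝ} (hc : 0 < c) (hsec : ENNReal.ofReal c ≤ μHE[d - 1] (hyperplane θ t ∩ K))
    {p : EuclideanSpace ℝ (Fin d)} (hp : p ∈ K) (hpt : t < inner ℝ p θ) :
    Var[fun x => inner ℝ x θ; volume.restrict K] ≤ 8 / c ^ 2 := by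
  have := isProbabilityMeasure_restrict hv
  set V := Var[fun x => inner ℝ x θ; volume.restrict K] with hV
  have hV0 : 0 ≤ V := variance_nonneg _ _
  set l := inner ℝ p θ - t with hl
  have hl0 : 0 < l := by linarith
  have key : ∀ r : ℝ, 0 < r → r < 1 → V * ((1 - r) ^ (d - 1) * c) ^ 2 ≤ 8 := by
    intro r hr0 hr1
    have hslice : ∀ s ∈ Set.Ioo t (t + r * l),
        ENNReal.ofReal ((1 - r) ^ (d - 1) * c) ≤ μHE[d - 1] (hyperplane θ s ∩ K) := by
      rintro s ⟨hs1, hs2⟩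
      set w := (s - t) / l with hw
      have hw0 : 0 < w := by have : 0 < s - t := by linarith
                             positivity
      have hwr : w < r := by rw [hw, div_lt_iff₀ hl0]; linarith
      have hsub : AffineMap.homothety p (1 - w) '' (hyperplane θ t ∩ K) ⊆ hyperplane θ s ∩ K := by
        rintro _ ⟨x, ⟨hx, hxK⟩, rfl⟩
        have hx' : inner ℝ x θ = t := hx
        have heq : AffineMap.homothety p (1 - w) x = (1 - w) • x + w • p := by
          rw [AffineMap.homothety_apply, vsub_eq_sub, vadd_eq_add]
          module
        rw [heq]
        refine ⟨?_, hK.1 hxK hp (by linarith) hw0.le (by ring)⟩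
        change inner ℝ ((1 - w) • x + w • p) θ = s
        rw [inner_add_left, inner_smul_left, inner_smul_left, hx', conj_trivial, conj_trivial]
        have : w * l = s - t := by rw [hw]; field_simp
        rw [hl] at this
        linarith
      refine le_trans ?_ (measure_mono hsub)
      rw [euclideanHausdorffMeasure_homothety_image _ _ (by linarith : 1 - w ≠ 0), ENNReal.smul_def,
        smul_eq_mul, ENNReal.ofReal_mul (by have : 0 < 1 - r := by linarith
                                            positivity)]
      gcongr
      rw [ENNReal.coe_pow, ← enorm_eq_nnnorm, Real.enorm_eq_ofReal (by linarith),
        ← ENNReal.ofReal_pow (by linarith)]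
      exact ENNReal.ofReal_le_ofReal (pow_le_pow_left₀ (by linarith) (by linarith) _)
    have hvol : ENNReal.ofReal ((1 - r) ^ (d - 1) * c * (r * l)) ≤
        (volume.restrict K) {x | t < inner ℝ x θ ∧ inner ℝ x θ < t + r * l} := by
      rw [volume_restrict_slab hK.2.1.measurableSet hθ]
      calc ENNReal.ofReal ((1 - r) ^ (d - 1) * c * (r * l))
          = ∫⁻ s in Set.Ioo t (t + r * l), ENNReal.ofReal ((1 - r) ^ (d - 1) * c) := by
            rw [setLIntegral_const, Real.volume_Ioo, add_sub_cancel_left, ENNReal.ofReal_mul]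
            have : 0 < 1 - r := by linarith
            positivity
        _ ≤ _ := setLIntegral_mono' measurableSet_Ioo hslice
    have hq : (1 - r) ^ (d - 1) * c * (r * l) ≤
        (volume.restrict K).real {x | t < inner ℝ x θ ∧ inner ℝ x θ < t + r * l} :=
      (ENNReal.ofReal_le_iff_le_toReal (measure_ne_top _ _)).1 hvol
    have h1r : 0 < 1 - r := by linarith
    have hh : 0 < r * l := by positivity
    have hconc := variance_inner_mul_sq_le hK hv θ t hh
    have h2 : V * ((1 - r) ^ (d - 1) * c * (r * l)) ^ 2 ≤ 8 * (r * l) ^ 2 :=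
      le_trans (by gcongr) hconc
    have h3 : V * ((1 - r) ^ (d - 1) * c) ^ 2 * (r * l) ^ 2 ≤ 8 * (r * l) ^ 2 := by
      linarith [mul_pow ((1 - r) ^ (d - 1) * c) (r * l) 2,
        congrArg (V * ·) (mul_pow ((1 - r) ^ (d - 1) * c) (r * l) 2)]
    exact le_of_mul_le_mul_right h3 (by positivity)
  have hlim : Filter.Tendsto (fun r : ℝ => V * ((1 - r) ^ (d - 1) * c) ^ 2)
      (nhdsWithin 0 (Set.Ioi 0)) (nhds (V * ((1 - 0) ^ (d - 1) * c) ^ 2)) :=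
    (Continuous.tendsto (by fun_prop) 0).mono_left nhdsWithin_le_nhds
  have hle := le_of_tendsto hlim (by
    filter_upwards [Ioo_mem_nhdsGT (zero_lt_one (α := ℝ))] with r hr using key r hr.1 hr.2)
  rw [le_div_iff₀ (by positivity)]
  simpa using hle

theorem variance_inner_le_of_le_section {d : ℕ} {K : Set (EuclideanSpace ℝ (Fin d))}
    (hK : IsFullConvexBody K) (hv : volume K = 1) {θ : EuclideanSpace ℝ (Fin d)} (hθ : ‖θ‖ = 1)
    {t c : ℝ} (hc : 0 < c) (hsec : ENNReal.ofReal c ≤ μHE[d - 1] (hyperplane θ t ∩ K)) :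
    Var[fun x => inner ℝ x θ; volume.restrict K] ≤ 8 / c ^ 2 := by
  obtain ⟨p, hpi, hpt⟩ := hK.exists_inner_ne hθ t
  have hp := interior_subset hpi
  rcases hpt.lt_or_gt with hlt | hgt
  · have hneg : hyperplane (-θ) (-t) = hyperplane θ t := by
      ext x
      simp [hyperplane, inner_neg_right]
    have h := variance_inner_le_of_le_section_of_lt hK hv (θ := -θ) (t := -t) (by rwa [norm_neg])
      hc (by rwa [hneg]) hp (by rw [inner_neg_right]; linarith)
    simp only [inner_neg_right] at h
    rwa [variance_fun_neg] at h
  · exact variance_inner_le_of_le_section_of_lt hK hv hθ hc hsec hp hgt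

/-- The direction of the large section is not under control, but in isotropic position all
directions have the same variance. -/
theorem HyperplaneConjecture.exists_isotropicVarianceLE (h : HyperplaneConjecture) :
    ∃ C, 0 < C ∧ IsotropicVarianceLE C := by
  obtain ⟨c, hc, h⟩ := h
  refine ⟨8 / c ^ 2, by positivity, fun d hd K hK hv hiso θ hθ => ?_⟩
  obtain ⟨θ', t, hθ', hsec⟩ := h d hd K hK hv
  obtain ⟨L, -, hL⟩ := hiso.exists_variance_inner_eq hK hv
  have h1 := variance_inner_le_of_le_section hK hv hθ' hc hsec
  rw [hL, hθ'] at h1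
  rwa [hL, hθ]

/-! ### Isotropic variance and floating bodies -/

/-- By Chebyshev, the half-space ⟨y, θ⟩ ≤ √(C/δ) omits at most δ of the mass, so it takes part in
the intersection. For x outside the ball, θ = x/‖x‖ gives a half-space that excludes x. -/
theorem IsotropicVarianceLE.lambdaTwo {C : ℝ} (hC : 0 < C) (h : IsotropicVarianceLE C) :
    LambdaTwo := by
  rintro δ ⟨hδ, -⟩
  have hr : 0 < √(C / δ) := by positivity
  refine ⟨√(C / δ), hr, fun d hd K hK hv hiso x hx => ?_⟩
  have := isProbabilityMeasure_restrict hv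
  rw [mem_closedBall_zero_iff]
  by_contra! hlt
  have hx0 : ‖x‖ ≠ 0 := (hr.trans hlt).ne'
  set θ := ‖x‖⁻¹ • x with hθdef
  have hθ : ‖θ‖ = 1 := by rw [hθdef, norm_smul, norm_inv, norm_norm, inv_mul_cancel₀ hx0]
  have hcheb := meas_ge_le_variance_div_sq (μ := volume.restrict K) (X := fun y => inner ℝ y θ)
    (hK.2.1.memLp_restrict (by fun_prop) 2) hr
  rw [hiso.integral_inner_eq_zero hK hv θ] at hcheb
  have hle : (volume.restrict K).real {y | √(C / δ) ≤ |inner ℝ y θ - 0|} ≤ δ := by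
    refine ENNReal.toReal_le_of_le_ofReal hδ.le (hcheb.trans (ENNReal.ofReal_le_ofReal ?_))
    rw [Real.sq_sqrt (by positivity), div_div_eq_mul_div]
    rw [div_le_iff₀ hC, mul_comm]
    gcongr
    exact h d hd K hK hv hiso θ hθ
  have hmem : halfSpace (-θ) (-√(C / δ)) ∈ {H | ∃ θ : EuclideanSpace ℝ (Fin d), ∃ t : ℝ, ‖θ‖ = 1 ∧
      H = halfSpace θ t ∧ (1 - δ) * volume.real K ≤ volume.real (H ∩ K)} := by
    refine ⟨_, _, by rwa [norm_neg], rfl, ?_⟩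
    have hm : MeasurableSet (halfSpace (-θ) (-√(C / δ))) :=
      measurableSet_le measurable_const (by fun_prop)
    rw [← measureReal_restrict_apply hm, measureReal_def volume K, hv, ENNReal.toReal_one, mul_one]
    have h1 := probReal_compl_eq_one_sub (μ := volume.restrict K) hm
    have h2 : (volume.restrict K).real (halfSpace (-θ) (-√(C / δ)))ᶜ ≤ δ := by
      refine le_trans (measureReal_mono fun y hy => ?_) hle
      simp only [halfSpace, Set.mem_compl_iff, Set.mem_ofPred_eq, not_le, inner_neg_right,
        neg_lt_neg_iff] at hy
      simpa using hy.le.trans (le_abs_self _)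
    linarith
  have hxH := hx _ hmem
  simp only [halfSpace, Set.mem_ofPred_eq, inner_neg_right, neg_le_neg_iff] at hxH
  rw [hθdef, inner_smul_right, real_inner_self_eq_norm_sq, pow_two, ← mul_assoc,
    inv_mul_cancel₀ hx0, one_mul] at hxH
  linarith

theorem LambdaTwo.lambdaOne (h : LambdaTwo) : LambdaOne := by
  have he := Real.exp_pos (-1)
  exact ⟨Real.exp (-1) / 2, ⟨by positivity, by linarith⟩, h _ ⟨by positivity, by linarith⟩⟩

theorem IsIsotropic.closedBall_subset_floatingBody {d : ℕ} {K : Set (EuclideanSpace ℝ (Fin d))}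
    (hK : IsFullConvexBody K) (hv : volume K = 1) (hiso : IsIsotropic K) {L : ℝ} (hL : 0 < L)
    (hvar : ∀ θ : EuclideanSpace ℝ (Fin d),
      Var[fun x => inner ℝ x θ; volume.restrict K] = L ^ 2 * ‖θ‖ ^ 2)
    {δ : ℝ} (hδ : δ < Real.exp (-1)) :
    Metric.closedBall 0 (L * (Real.exp (-1) - δ) / 6) ⊆ floatingBody K δ := by
  have := isProbabilityMeasure_restrict hv
  set ε := Real.exp (-1) - δ with hε
  have hε0 : 0 < ε := by linarith
  -- The density bound for a slab of width 2ρ reads L²ε² ≤ 32ρ²; the divisor 6 contradicts it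
  -- because 32 < 6².
  set ρ := L * ε / 6 with hρ
  have hρ0 : 0 < ρ := by positivity
  rintro x hx _ ⟨θ, t, hθ, rfl, hH⟩
  rw [mem_closedBall_zero_iff] at hx
  have hxθ : -ρ ≤ inner ℝ x θ := by
    have h1 := abs_real_inner_le_norm x θ
    rw [hθ, mul_one] at h1
    linarith [(abs_le.1 h1).1]
  suffices t ≤ -ρ from this.trans hxθ
  by_contra! ht
  have hm : MeasurableSet (halfSpace θ t) := measurableSet_le measurable_const (by fun_prop)
  rw [← measureReal_restrict_apply hm, measureReal_def volume K, hv, ENNReal.toReal_one,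
    mul_one] at hH
  have hcompl := probReal_compl_eq_one_sub (μ := volume.restrict K) hm
  obtain ⟨R, hR⟩ := (hK.2.1.image (f := fun y => inner ℝ y (-θ)) (by fun_prop)).isBounded
    |>.exists_norm_le
  have hgr := exp_neg_one_le_measureReal_of_isLogConcave (μ := volume.restrict K)
    (X := fun y => inner ℝ y (-θ)) (by fun_prop)
    ((ae_restrict_mem hK.2.1.measurableSet).mono fun y hy => hR _ ⟨y, hy, rfl⟩)
    (hiso.integral_inner_eq_zero hK hv _) (hK.1.isLogConcave_measureReal_le_inner hK.2.1 _)
  -- If t > -ρ, then of the mass at least 1/e in ⟨y, θ⟩ ≤ 0, at most δ lies below -ρ. The rest, at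
  -- least ε, is in the open slab (-ρ, ρ), chosen to contain the boundary ⟨y, θ⟩ = 0.
  have hconc := variance_inner_mul_sq_le hK hv θ (-ρ) (h := 2 * ρ) (by positivity)
  set q := (volume.restrict K).real {y | -ρ < inner ℝ y θ ∧ inner ℝ y θ < -ρ + 2 * ρ} with hq
  have hcover : (volume.restrict K).real {y | 0 ≤ inner ℝ y (-θ)} ≤
      (volume.restrict K).real (halfSpace θ t)ᶜ + q := by
    refine le_trans (measureReal_mono fun y hy => ?_) (measureReal_union_le _ _)
    simp only [Set.mem_ofPred_eq, inner_neg_right] at hy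
    by_cases hy' : -ρ < inner ℝ y θ
    · exact Or.inr ⟨hy', by linarith⟩
    · refine Or.inl ?_
      simp only [halfSpace, Set.mem_compl_iff, Set.mem_ofPred_eq, not_le]
      linarith
  have hqε : ε ≤ q := by linarith
  rw [hvar, hθ] at hconc
  have h1 : L ^ 2 * 1 ^ 2 * ε ^ 2 ≤ L ^ 2 * 1 ^ 2 * q ^ 2 := by gcongr
  have h2 : 8 * (2 * ρ) ^ 2 = 32 / 36 * (L ^ 2 * ε ^ 2) := by rw [hρ]; ring
  have h3 : 0 < L ^ 2 * ε ^ 2 := by positivity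
  linarith

theorem LambdaOne.exists_isotropicVarianceLE (h : LambdaOne) :
    ∃ C, 0 < C ∧ IsotropicVarianceLE C := by
  obtain ⟨δ, ⟨-, hδ⟩, r, hr, h⟩ := h
  have hε0 : 0 < Real.exp (-1) - δ := by linarith
  refine ⟨(6 * r / (Real.exp (-1) - δ)) ^ 2, by positivity, fun d hd K hK hv hiso θ hθ => ?_⟩
  obtain ⟨L, hL, hvar⟩ := hiso.exists_variance_inner_eq hK hv
  have hmem := h d hd K hK hv hiso (hiso.closedBall_subset_floatingBody hK hv hL hvar hδ
    (show (L * (Real.exp (-1) - δ) / 6) • θ ∈ Metric.closedBall 0 _ by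
      rw [mem_closedBall_zero_iff, norm_smul, hθ, mul_one, Real.norm_eq_abs,
        abs_of_pos (by positivity)]))
  rw [mem_closedBall_zero_iff, norm_smul, hθ, mul_one, Real.norm_eq_abs,
    abs_of_pos (by positivity)] at hmem
  rw [hvar, hθ, one_pow, mul_one]
  gcongr
  rw [le_div_iff₀ hε0]
  linarith

/-! ### Isotropic position and existence of a large section -/

theorem IsFullConvexBody.variance_inner_pos {d : ℕ} {K : Set (EuclideanSpace ℝ (Fin d))}
    (hK : IsFullConvexBody K) (hv : volume K = 1) {θ : EuclideanSpace ℝ (Fin d)} (hθ : ‖θ‖ = 1) :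
    0 < Var[fun x => inner ℝ x θ; volume.restrict K] := by
  have := isProbabilityMeasure_restrict hv
  refine (variance_nonneg _ _).lt_of_ne' fun h0 => ?_
  have hae := ae_eq_integral_of_variance_eq_zero
    (hK.2.1.memLp_restrict (f := fun x => inner ℝ x θ) (by fun_prop) 2) h0
  obtain ⟨p, hp, hne⟩ := hK.exists_inner_ne hθ (∫ x, inner ℝ x θ ∂(volume.restrict K))
  exact hne (Measure.eqOn_open_of_ae_eq
    (ae_restrict_of_ae_restrict_of_subset interior_subset hae) isOpen_interior
    (by fun_prop) continuousOn_const hp)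

/-- Principal axes of the uniform distribution on a convex body. -/
theorem IsFullConvexBody.exists_orthonormalBasis_covariance {d : ℕ}
    {K : Set (EuclideanSpace ℝ (Fin d))} (hK : IsFullConvexBody K) (hv : volume K = 1) :
    ∃ (b : OrthonormalBasis (Fin d) ℝ (EuclideanSpace ℝ (Fin d))) (l : Fin d → ℝ),
      (∀ i, 0 < l i) ∧ (∀ i, Var[fun x => inner ℝ x (b i); volume.restrict K] = l i) ∧
      ∀ i j, cov[fun x => inner ℝ (b i) x, fun x => inner ℝ (b j) x; volume.restrict K] =
        if i = j then l i else 0 := by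
  have := isProbabilityMeasure_restrict hv
  have hmem : MemLp id 2 (volume.restrict K) := hK.2.1.memLp_restrict continuous_id 2
  set A := InnerProductSpace.continuousLinearMapOfBilin (covarianceBilin (volume.restrict K))
    with hA
  have hAapp : ∀ x y, inner ℝ (A x) y = covarianceBilin (volume.restrict K) x y := fun x y =>
    InnerProductSpace.continuousLinearMapOfBilin_apply _ x y
  have hsymm : A.toLinearMap.IsSymmetric := fun x y => by
    change inner ℝ (A x) y = inner ℝ x (A y)
    rw [hAapp, real_inner_comm, hAapp, covarianceBilin_comm]
  set b := hsymm.eigenvectorBasis (finrank_euclideanSpace_fin (𝕜 := ℝ) (n := d)) with hb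
  set l := hsymm.eigenvalues (finrank_euclideanSpace_fin (𝕜 := ℝ) (n := d)) with hl
  have hcov : ∀ i j, covarianceBilin (volume.restrict K) (b i) (b j) = if i = j then l i else 0 := by
    intro i j
    have h1 : A (b i) = l i • b i := hsymm.apply_eigenvectorBasis _ i
    rw [← hAapp, h1, inner_smul_left, b.inner_eq_ite]
    simp
  have hvar : ∀ i, Var[fun x => inner ℝ x (b i); volume.restrict K] = l i := by
    intro i
    have h1 := covarianceBilin_self hmem (b i)
    rw [hcov, if_pos rfl] at h1
    simp only [real_inner_comm (b i)]
    exact h1.symm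
  refine ⟨b, l, fun i => ?_, hvar, fun i j => ?_⟩
  · rw [← hvar]
    exact hK.variance_inner_pos hv (b.norm_eq_one i)
  · rw [← covarianceBilin_apply_eq_cov hmem, hcov]

theorem measurePreserving_toEuclideanLin_diagonal {d : ℕ} {v : Fin d → ℝ} (hv : ∏ i, v i = 1) :
    MeasurePreserving (Matrix.toEuclideanLin (Matrix.diagonal v)) := by
  have hdet : LinearMap.det (Matrix.toEuclideanLin (Matrix.diagonal v)) = 1 := by
    rw [Matrix.toEuclideanLin_eq_toLin_orthonormal, LinearMap.det_toLin, Matrix.det_diagonal, hv]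
  refine ⟨(LinearMap.continuous_of_finiteDimensional _).measurable, ?_⟩
  rw [Measure.map_linearMap_addHaar_eq_smul_addHaar _ (by rw [hdet]; exact one_ne_zero), hdet]
  simp

open Pointwise in
/-- By passing to isotropic position, every convex body of unit volume has a direction of small
variance. -/
theorem IsFullConvexBody.exists_variance_inner_le {d : ℕ} (hd : 1 ≤ d) {C : ℝ}
    (hC : IsotropicVarianceLE C) {K : Set (EuclideanSpace ℝ (Fin d))}
    (hK : IsFullConvexBody K) (hv : volume K = 1) :
    ∃ θ : EuclideanSpace ℝ (Fin d), ‖θ‖ = 1 ∧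
      Var[fun x => inner ℝ x θ; volume.restrict K] ≤ C := by
  have := isProbabilityMeasure_restrict hv
  have : Nonempty (Fin d) := ⟨⟨0, hd⟩⟩
  obtain ⟨b, l, hl, hvar, hcov⟩ := hK.exists_orthonormalBasis_covariance hv
  set S := ∏ i, √(l i) with hS
  have hS0 : 0 < S := Finset.prod_pos fun i _ => Real.sqrt_pos.2 (hl i)
  -- L is the geometric mean of the principal standard deviations, the only common value reachable
  -- by a rescaling of the axes that preserves volume.
  set L := S ^ ((d : ℝ)⁻¹) with hL
  have hL0 : 0 < L := Real.rpow_pos_of_pos hS0 _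
  have hLd : L ^ d = S := Real.rpow_inv_natCast_pow hS0.le (by omega)
  set v : Fin d → ℝ := fun i => L / √(l i) with hvdef
  have hv0 : ∀ i, 0 < v i := fun i => div_pos hL0 (Real.sqrt_pos.2 (hl i))
  have hvprod : ∏ i, v i = 1 := by
    rw [hvdef, Finset.prod_div_distrib, Finset.prod_const, Finset.card_univ, Fintype.card_fin, hLd,
      div_self hS0.ne']
  set D := Matrix.toEuclideanLin (Matrix.diagonal v) with hD
  have hDapp : ∀ x i, D x i = v i * x i := fun x i => by
    simp [hD, Matrix.toEuclideanLin, Matrix.mulVec_diagonal]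
  set m : EuclideanSpace ℝ (Fin d) := ∫ x, x ∂(volume.restrict K) with hm
  set T : EuclideanSpace ℝ (Fin d) →L[ℝ] EuclideanSpace ℝ (Fin d) :=
    D.toContinuousLinearMap ∘L (b.repr.toContinuousLinearEquiv : _ →L[ℝ] _) with hT
  have hTapp : ∀ x i, T x i = v i * inner ℝ (b i) x := fun x i => by
    change D (b.repr x) i = _
    rw [hDapp, b.repr_apply_apply]
  have hTinj : Function.Injective T := by
    intro x y hxy
    refine b.repr.injective ?_
    ext i
    have h1 := congrArg (fun z : EuclideanSpace ℝ (Fin d) => z i) hxy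
    simp only [hTapp] at h1
    rw [b.repr_apply_apply, b.repr_apply_apply]
    exact mul_left_cancel₀ (hv0 i).ne' h1
  set f : EuclideanSpace ℝ (Fin d) → EuclideanSpace ℝ (Fin d) := fun x => T (x - m) with hf
  have hfc : Continuous f := by fun_prop
  have hfinj : Function.Injective f := hTinj.comp (sub_left_injective)
  have hfmp : MeasurePreserving f := ((measurePreserving_toEuclideanLin_diagonal hvprod).comp
    b.measurePreserving_repr).comp (measurePreserving_sub_right volume m)
  have hfemb : MeasurableEmbedding f := hfc.measurableEmbedding hfinj
  have hmap : volume.restrict (f '' K) = (volume.restrict K).map f :=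
    (hfmp.restrict_image_emb hfemb K).map_eq.symm
  have hv' : volume (f '' K) = 1 := by
    rw [← hfmp.measure_preimage_emb hfemb, Set.preimage_image_eq _ hfinj, hv]
  have hconv : Convex ℝ (f '' K) := by
    have h1 : f '' K = T.toLinearMap '' ((fun x => x - m) '' K) := by
      rw [Set.image_image]
      rfl
    rw [h1, ← Set.sub_singleton]
    exact (Convex.sub hK.1 (convex_singleton m)).linear_image _
  have hcomp : IsCompact (f '' K) := hK.2.1.image hfc
  have hK' : IsFullConvexBody (f '' K) := by
    refine ⟨hconv, hcomp, ?_⟩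
    -- A convex set has null frontier, so a compact one with empty interior would have volume 0.
    by_contra hemp
    rw [Set.not_nonempty_iff_eq_empty] at hemp
    have h1 := hconv.addHaar_frontier volume
    rw [frontier, hemp, Set.sdiff_empty, hcomp.isClosed.closure_eq, hv'] at h1
    exact one_ne_zero h1
  have hint : Integrable (fun x => x) (volume.restrict K) :=
    memLp_one_iff_integrable.1 (hK.2.1.memLp_restrict continuous_id 1)
  have hcov' : ∀ i j : Fin d, cov[fun x : EuclideanSpace ℝ (Fin d) => x i, fun x => x j;
      volume.restrict (f '' K)] = if i = j then L ^ 2 else 0 := by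
    intro i j
    have hinti : ∀ i, Integrable (fun x => inner ℝ (b i) x) (volume.restrict K) := fun i =>
      memLp_one_iff_integrable.1 (hK.2.1.memLp_restrict (by fun_prop) 1)
    rw [hmap, covariance_map_fun (Continuous.aestronglyMeasurable (by fun_prop))
      (Continuous.aestronglyMeasurable (by fun_prop)) hfc.aemeasurable]
    simp only [hf, hTapp, inner_sub_right]
    rw [covariance_const_mul_left, covariance_const_mul_right,
      covariance_sub_const_left (hinti i), covariance_sub_const_right (hinti j), hcov]
    split_ifs with hij
    · subst hij
      have h1 := Real.sq_sqrt (hl i).le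
      have h2 := (Real.sqrt_pos.2 (hl i)).ne'
      calc v i * (v i * l i) = L ^ 2 * (l i / √(l i) ^ 2) := by rw [hvdef]; field_simp
        _ = L ^ 2 := by rw [h1, div_self (hl i).ne', mul_one]
    · simp
  have hiso : IsIsotropic (f '' K) := by
    rw [IsIsotropic, cond_volume_eq_restrict hv']
    refine ⟨?_, L, hL0, hcov'⟩
    rw [hmap, hfemb.integral_map]
    simp only [hf]
    have hint' : Integrable (fun x => x - m) (volume.restrict K) := hint.sub (integrable_const m)
    rw [T.integral_comp_comm hint', integral_sub hint (integrable_const m)]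
    simp [← hm]
  have hLC : L ^ 2 ≤ C := by
    have h1 := hC d hd _ hK' hv' hiso (EuclideanSpace.single ⟨0, hd⟩ 1) (by simp)
    have h2 := hcov' ⟨0, hd⟩ ⟨0, hd⟩
    rw [if_pos rfl, covariance_self (by fun_prop)] at h2
    simpa [EuclideanSpace.inner_single_right, h2] using h1
  -- Some factor is at most the geometric mean; its axis is the required direction.
  have hex : ∃ i, √(l i) ≤ L := by
    by_contra! hcon
    have h1 := Finset.prod_lt_prod_of_nonempty (fun i _ => hL0) (fun i _ => hcon i)
      (Finset.univ_nonempty (α := Fin d))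
    rw [Finset.prod_const, Finset.card_univ, Fintype.card_fin, hLd] at h1
    exact lt_irrefl _ h1
  obtain ⟨i, hi⟩ := hex
  refine ⟨b i, b.norm_eq_one i, ?_⟩
  rw [hvar]
  exact ((Real.sqrt_le_left hL0.le).1 hi).trans hLC

/-- Chebyshev leaves mass at least 3/4 in the slab of half-width 2σ about the mean. If all sections
were below 1/(8σ), this slab of width 4σ would have mass at most 1/2. -/
theorem IsFullConvexBody.exists_le_section {d : ℕ} {K : Set (EuclideanSpace ℝ (Fin d))}
    (hK : IsFullConvexBody K) (hv : volume K = 1) {θ : EuclideanSpace ℝ (Fin d)} (hθ : ‖θ‖ = 1)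
    {σ : ℝ} (hσ : 0 < σ) (hvar : Var[fun x => inner ℝ x θ; volume.restrict K] ≤ σ ^ 2) :
    ∃ t, ENNReal.ofReal (1 / (8 * σ)) ≤ μHE[d - 1] (hyperplane θ t ∩ K) := by
  have := isProbabilityMeasure_restrict hv
  by_contra! hcon
  set M := ∫ x, inner ℝ x θ ∂(volume.restrict K) with hM
  have hcheb := meas_ge_le_variance_div_sq (μ := volume.restrict K) (X := fun y => inner ℝ y θ)
    (hK.2.1.memLp_restrict (by fun_prop) 2) (c := 2 * σ) (by positivity)
  have hfar : (volume.restrict K) {y | 2 * σ ≤ |inner ℝ y θ - M|} ≤ ENNReal.ofReal (1 / 4) := by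
    refine hcheb.trans (ENNReal.ofReal_le_ofReal ?_)
    rw [div_le_iff₀ (by positivity)]
    linarith [mul_pow 2 σ 2]
  have hnear : (volume.restrict K) {y | M - 2 * σ < inner ℝ y θ ∧ inner ℝ y θ < M + 2 * σ} ≤
      ENNReal.ofReal (1 / 2) := by
    rw [volume_restrict_slab hK.2.1.measurableSet hθ]
    calc _ ≤ ∫⁻ t in Set.Ioo (M - 2 * σ) (M + 2 * σ), ENNReal.ofReal (1 / (8 * σ)) :=
          lintegral_mono fun t => (hcon t).le
      _ = ENNReal.ofReal (1 / 2) := by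
          rw [setLIntegral_const, Real.volume_Ioo, ← ENNReal.ofReal_mul (by positivity)]
          congr 1
          field_simp
          ring
  have hone : (1 : ENNReal) ≤ ENNReal.ofReal (1 / 4) + ENNReal.ofReal (1 / 2) := by
    calc (1 : ENNReal) = (volume.restrict K) Set.univ := measure_univ.symm
      _ ≤ (volume.restrict K) ({y | 2 * σ ≤ |inner ℝ y θ - M|} ∪
            {y | M - 2 * σ < inner ℝ y θ ∧ inner ℝ y θ < M + 2 * σ}) := by
          refine measure_mono fun y _ => ?_
          rcases le_or_gt (2 * σ) |inner ℝ y θ - M| with h | h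
          · exact Or.inl h
          · have := abs_lt.1 h
            exact Or.inr ⟨by linarith, by linarith⟩
      _ ≤ _ := (measure_union_le _ _).trans (add_le_add hfar hnear)
  rw [← ENNReal.ofReal_add (by norm_num) (by norm_num), ENNReal.one_le_ofReal] at hone
  norm_num at hone

theorem IsotropicVarianceLE.hyperplaneConjecture {C : ℝ} (hC : 0 < C)
    (h : IsotropicVarianceLE C) : HyperplaneConjecture := by
  refine ⟨1 / (8 * √C), by positivity, fun d hd K hK hv => ?_⟩
  obtain ⟨θ, hθ, hvar⟩ := hK.exists_variance_inner_le hd h hv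
  obtain ⟨t, ht⟩ := hK.exists_le_section hv hθ (Real.sqrt_pos.2 hC) (by rwa [Real.sq_sqrt hC.le])
  exact ⟨θ, t, hθ, ht⟩

theorem theorem1 :
    (HyperplaneConjecture ↔ LambdaOne) ∧ (HyperplaneConjecture ↔ LambdaTwo) := by
  have h1 : HyperplaneConjecture → LambdaTwo := fun h => by
    obtain ⟨C, hC, h⟩ := h.exists_isotropicVarianceLE
    exact h.lambdaTwo hC
  have h2 : LambdaOne → HyperplaneConjecture := fun h => by
    obtain ⟨C, hC, h⟩ := h.exists_isotropicVarianceLE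
    exact h.hyperplaneConjecture hC
  exact ⟨⟨fun h => (h1 h).lambdaOne, h2⟩, ⟨h1, fun h => h2 h.lambdaOne⟩⟩
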